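/- All Banach spaces are real, operators are bounded linear maps, and $\mathbb N=\{1,2,\dots\}$. Let $\ell_\infty^m(\ell_1^m)$ be the space of real $m\times m$ arrays with norm $\|(a_{i,j})\|=\max_i\sum_j|a_{i,j}|$, let $L_1=L_1[0,1]$ (Lebesgue measure), and let $\Omega_k$ be the set $\{1,\dots,k\}$ with the uniform probability measure. A family of operators $(U_i\colon E_i\to F_i)_{i\in I}$ *uniformly factors through* a family $(V_j\colon G_j\to H_j)_{j\in J}$ if there is $C>0$ such that for every $i\in I$ there are $j\in J$ and operators $A\colon E_i\to G_j$, $B\colon H_j\to F_i$ with $U_i=BV_jA$ and $\|A\|\cdot\|B\|\le C$; it uniformly factors through the spaces $G_j$ if it uniformly factors through their identity operators. The $2$-summing norm of an operator $U\colon E\to F$ is $$\pi_2(U)=\sup\Big\{\Big(\sum_{s=1}^k\|Uz^{(s)}\|^2\Big)^{1/2}:\ k\in\mathbb N,\ z^{(1)},\dots,z^{(k)}\in E,\ \sum_{s=1}^k|\langle z^{(s)},z^*\rangle|^2\le 1\ \text{ for all } z^*\in B_{E^*}\Big\}\in[0,\infty],$$ where $B_{E^*}$ is the closed unit ball of the dual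 space $E^*$. **Theorem 5.1.** Let $T^{(m)}\colon \ell_\infty^m(\ell_1^m)\to L_1$ ($m\in\mathbb N$) be operators with $\sup_m\|T^{(m)}\|<\infty$. Then the following are equivalent. (i) The $T^{(m)}$ uniformly factor through $\ell_\infty^k$ ($k\in\mathbb N$). (ii) $\sup_m\pi_2(T^{(m)})<\infty$. (iii) The $T^{(m)}$ uniformly factor through the formal identity maps $\iota_k\colon\ell_\infty^k\to L_2(\Omega_k)$, $x\mapsto\sum_{i=1}^k x_i\mathbf 1_{\{i\}}$ ($k\in\mathbb N$). -/

import Mathlib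

open MeasureTheory
open scoped ENNReal

noncomputable section

/-- The space `ℓ_∞^k`, i.e. `ℝ^k` with the maximum norm. -/
abbrev EllInf (k : ℕ) : Type := Fin k → ℝ

/-- The space `ℓ_∞^m(ℓ_1^m)`: the `ℓ_∞`-sum of `m` copies of `ℓ_1^m`, so that the norm of
`(a_{i,j})` is `max_i ∑_j |a_{i,j}|`. -/
abbrev EllInfEllOne (m : ℕ) : Type := Fin m → PiLp 1 (fun _ : Fin m => ℝ)

/-- The real Banach space `L_1 = L_1[0,1]` for Lebesgue measure. -/
abbrev LOne : Type := Lp ℝ 1 (volume.restrict (Set.Icc (0 : ℝ) 1))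

/-- The uniform measure `μ_k` on `{1, …, k}`, with `μ_k {i} = 1 / k`. -/
def unifMeasure (k : ℕ) : Measure (Fin k) := (k : ℝ≥0∞)⁻¹ • Measure.count

theorem unifMeasure_singleton (k : ℕ) (i : Fin k) : unifMeasure k {i} = (k : ℝ≥0∞)⁻¹ := by
  simp [unifMeasure]

instance instIsProbabilityMeasureUnifMeasure (k : ℕ+) :
    IsProbabilityMeasure (unifMeasure (k : ℕ)) where
  measure_univ := by
    have h0 : ((k : ℕ) : ℝ≥0∞) ≠ 0 := by exact_mod_cast k.ne_zero
    simp [unifMeasure, Measure.count_univ, ENNReal.inv_mul_cancel h0 (ENNReal.natCast_ne_top _)]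

/-- The space `L_2(Ω_k)`, where `Ω_k` is `{1, …, k}` with the uniform probability measure. -/
abbrev LTwoOmega (k : ℕ+) : Type := Lp ℝ 2 (unifMeasure (k : ℕ))

theorem memLp_unifMeasure (k : ℕ+) (x : EllInf k) : MemLp x 2 (unifMeasure (k : ℕ)) :=
  MemLp.of_bound (measurable_of_finite x).aestronglyMeasurable ‖x‖
    (Filter.Eventually.of_forall (norm_le_pi_norm x))

/-- The formal identity `ι_k : ℓ_∞^k → L_2(Ω_k)`, sending `x` to the class of the function
`i ↦ x i`. -/
def formalIdentity (k : ℕ+) : EllInf k →L[ℝ] LTwoOmega k :=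
  LinearMap.toContinuousLinearMap
    { toFun := fun x => (memLp_unifMeasure k x).toLp x
      map_add' := fun _ _ => rfl
      map_smul' := fun _ _ => rfl }

/-- The family `U` uniformly factors through the family `V`: there is one constant `C` such
that each `U i` can be written as `B ∘ V j ∘ A` for some `j` with `‖A‖ * ‖B‖ ≤ C`. -/
def UniformlyFactorThrough {I J : Type*} {E F : I → Type*} {G H : J → Type*}
    [∀ i, NormedAddCommGroup (E i)] [∀ i, NormedSpace ℝ (E i)]
    [∀ i, NormedAddCommGroup (F i)] [∀ i, NormedSpace ℝ (F i)]
    [∀ j, NormedAddCommGroup (G j)] [∀ j, NormedSpace ℝ (G j)]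
    [∀ j, NormedAddCommGroup (H j)] [∀ j, NormedSpace ℝ (H j)]
    (U : ∀ i, E i →L[ℝ] F i) (V : ∀ j, G j →L[ℝ] H j) : Prop :=
  ∃ C : ℝ, 0 < C ∧ ∀ i, ∃ (j : J) (A : E i →L[ℝ] G j) (B : H j →L[ℝ] F i),
    U i = B ∘L V j ∘L A ∧ ‖A‖ * ‖B‖ ≤ C

/-- The `2`-summing norm `π_2(U)`, with the value `∞` when `U` is not `2`-summing. -/
def twoSummingNorm {E F : Type*} [NormedAddCommGroup E] [NormedSpace ℝ E]
    [NormedAddCommGroup F] [NormedSpace ℝ F] (U : E →L[ℝ] F) : ℝ≥0∞ :=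
  ⨆ (k : ℕ) (z : Fin k → E)
    (_ : ∀ φ : StrongDual ℝ E, ‖φ‖ ≤ 1 → ∑ s, |φ (z s)| ^ 2 ≤ 1),
    ENNReal.ofReal (Real.sqrt (∑ s, ‖U (z s)‖ ^ 2))

end

/-! (i) ⇒ (ii) is Grothendieck's theorem: every operator `B` from `ℓ_∞^k` to an `L_1` space has
`π_2` at most `8‖B‖`. The Hilbert-valued bound `Γ` improves itself (`HilbertBound.improve`):
Khinchine turns norms into averages of random signs, truncation leaves a bounded scalar part and a
small Hilbert-valued remainder, so `Γ` may be replaced by `4β + Γ/2`, whose fixed point is `8β`.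

(ii) ⇒ (iii) is Pietsch domination (`TwoSummingWith.exists_form`): separation and compactness yield
a convex combination of squares of functionals dominating `‖T x‖ ^ 2`. Rounding its weights to a
uniform average costs a factor `2` and makes the dominating operator pass through some `ι_k`; an
orthogonal projection then gives the factorization.

(iii) ⇒ (i) holds because each `ι_k` is a contraction. -/

/-! ### Random signs and Khinchine's inequality. -/

/-- The sum `∑ ± a i` with the signs given by `σ`. -/
def signedSum {n : ℕ} (σ : Fin n → Bool) (a : Fin n → ℝ) : ℝ :=
  ∑ i, (if σ i then 1 else -1) * a i

theorem signedSum_sum {n k : ℕ} (σ : Fin n → Bool) (c : Fin k → ℝ) (a : Fin k → Fin n → ℝ) :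
    signedSum σ (fun s => ∑ i, c i * a i s) = ∑ i, c i * signedSum σ (a i) := by
  simp only [signedSum, Finset.mul_sum]
  rw [Finset.sum_comm]
  exact Finset.sum_congr rfl fun i _ => Finset.sum_congr rfl fun s _ => by ring

theorem sum_signs_succ {n : ℕ} (f : (Fin (n + 1) → Bool) → ℝ) :
    ∑ σ, f σ = ∑ σ : Fin n → Bool, (f (Fin.cons true σ) + f (Fin.cons false σ)) := by
  rw [← (Fin.consEquiv fun _ => Bool).sum_comp, Fintype.sum_prod_type_right]
  simp [Fin.consEquiv]

theorem signedSum_cons {n : ℕ} (b : Bool) (σ : Fin n → Bool) (a : Fin (n + 1) → ℝ) :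
    signedSum (Fin.cons b σ : Fin (n + 1) → Bool) a =
      (if b then 1 else -1) * a 0 + signedSum σ (Fin.tail a) := by
  simp [signedSum, Fin.sum_univ_succ, Fin.tail]

theorem sum_signedSum_sq {n : ℕ} (a : Fin n → ℝ) :
    ∑ σ, signedSum σ a ^ 2 = 2 ^ n * ∑ i, a i ^ 2 := by
  induction n with
  | zero => simp [signedSum]
  | succ n ih =>
    have h := ih (Fin.tail a)
    rw [sum_signs_succ, Fin.sum_univ_succ]
    calc _ = ∑ σ : Fin n → Bool, (2 * a 0 ^ 2 + 2 * signedSum σ (Fin.tail a) ^ 2) :=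
          Finset.sum_congr rfl fun σ _ => by simp only [signedSum_cons]; simp; ring
      _ = _ := by
          rw [Finset.sum_add_distrib, ← Finset.mul_sum (f := fun σ => signedSum σ _ ^ 2), h]
          simp [Fin.tail, pow_succ]; ring

/-- Averaging over the first sign kills the odd powers; raising `2 * a 0 ^ 4` to `6 * a 0 ^ 4` then
completes the square. -/
theorem sum_signedSum_pow_four_le {n : ℕ} (a : Fin n → ℝ) :
    ∑ σ, signedSum σ a ^ 4 ≤ 3 * 2 ^ n * (∑ i, a i ^ 2) ^ 2 := by
  induction n with
  | zero => simp [signedSum]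
  | succ n ih =>
    have h := ih (Fin.tail a)
    rw [sum_signs_succ, Fin.sum_univ_succ]
    calc _ = ∑ σ : Fin n → Bool, (2 * a 0 ^ 4 + 12 * a 0 ^ 2 * signedSum σ (Fin.tail a) ^ 2
            + 2 * signedSum σ (Fin.tail a) ^ 4) :=
          Finset.sum_congr rfl fun σ _ => by simp only [signedSum_cons]; simp; ring
      _ = 2 ^ n * (2 * a 0 ^ 4) + 12 * a 0 ^ 2 * (2 ^ n * ∑ i, Fin.tail a i ^ 2)
            + 2 * ∑ σ : Fin n → Bool, signedSum σ (Fin.tail a) ^ 4 := by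
          rw [Finset.sum_add_distrib, Finset.sum_add_distrib, ← Finset.mul_sum (f := fun σ => signedSum σ _ ^ 2),
            ← Finset.mul_sum (f := fun σ => signedSum σ _ ^ 4), sum_signedSum_sq]
          simp
      _ ≤ 2 ^ n * (2 * a 0 ^ 4) + 12 * a 0 ^ 2 * (2 ^ n * ∑ i, Fin.tail a i ^ 2)
            + 2 * (3 * 2 ^ n * (∑ i, Fin.tail a i ^ 2) ^ 2) := by gcongr
      _ ≤ 2 ^ n * (6 * a 0 ^ 4) + 12 * a 0 ^ 2 * (2 ^ n * ∑ i, Fin.tail a i ^ 2)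
            + 2 * (3 * 2 ^ n * (∑ i, Fin.tail a i ^ 2) ^ 2) := by
          have : 0 ≤ a 0 ^ 4 := by positivity
          gcongr; norm_num
      _ = _ := by simp only [Fin.tail]; ring

/-- Khinchine's inequality between the first and the second moment, with constant `2`. -/
theorem khinchine_one_two {n : ℕ} (a : EuclideanSpace ℝ (Fin n)) :
    2 ^ n * ‖a‖ ≤ 2 * ∑ σ, |signedSum σ a| := by
  rcases eq_or_ne a 0 with rfl | ha
  · simp; positivity
  have hs : 0 < ‖a‖ := norm_pos_iff.2 ha
  have hsq : ∑ i, a i ^ 2 = ‖a‖ ^ 2 := by simp [EuclideanSpace.norm_sq_eq]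
  set s := ‖a‖
  -- A minorant of `|u|` by second and fourth powers; the weight `1/6` makes the fourth moment cost
  -- exactly half of the second.
  have hpt : ∀ u : ℝ, u ^ 2 * s ^ 2 - u ^ 4 / 6 ≤ s ^ 3 * |u| := by
    intro u
    rw [← sq_abs u, ← (by decide : Even 4).pow_abs u]
    have hu := abs_nonneg u
    set v := |u|
    -- For `c = 1.43` the product `(v - cs)²(v + 2cs) = v³ - 3c²vs² + 2c³s³` suffices, since `3c² ≥
    -- 6` and `2c³ ≤ 6`.
    have h1 : 0 ≤ (v - 1.43 * s) ^ 2 * (v + 2.86 * s) := by positivity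
    have h2 : 0 ≤ v * s ^ 2 := by positivity
    have h3 : 0 ≤ s ^ 3 := by positivity
    have h4 : 0 ≤ v ^ 3 + 6 * s ^ 3 - 6 * (v * s ^ 2) := by nlinarith
    nlinarith [mul_nonneg hu h4]
  have h : ∑ σ, (signedSum σ a ^ 2 * s ^ 2 - signedSum σ a ^ 4 / 6) ≤
      ∑ σ, s ^ 3 * |signedSum σ a| := Finset.sum_le_sum fun σ _ => hpt _
  rw [Finset.sum_sub_distrib, ← Finset.sum_mul, ← Finset.sum_div, ← Finset.mul_sum,
    sum_signedSum_sq, hsq] at h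
  have h4 := sum_signedSum_pow_four_le a
  rw [hsq] at h4
  refine le_of_mul_le_mul_left ?_ (pow_pos hs 3)
  linarith

/-! ### Grothendieck's theorem by self-improvement. -/

/-- `Γ` bounds the extension of `x ↦ ∑ x i • b i` to Hilbert-space valued `x`. -/
def HilbertBound {α : Type*} [MeasurableSpace α] (μ : Measure α) {k : ℕ} (b : Fin k → α → ℝ)
    (Γ : ℝ) : Prop :=
  ∀ (ι : Type) [Fintype ι] (R : ℝ) (Z : Fin k → EuclideanSpace ℝ ι), (∀ i, ‖Z i‖ ≤ R) →
    ∫ t, ‖∑ i, b i t • Z i‖ ∂μ ≤ Γ * R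

section
variable {α : Type*} [MeasurableSpace α] {μ : Measure α} {k : ℕ} {b : Fin k → α → ℝ}

theorem integrable_sum_smul (hb : ∀ i, Integrable (b i) μ) {H : Type*} [NormedAddCommGroup H]
    [NormedSpace ℝ H] (Z : Fin k → H) : Integrable (fun t => ∑ i, b i t • Z i) μ :=
  integrable_finsetSum _ fun i _ => (hb i).smul_const _

/-- Only finiteness matters: this bound, dependent on `b`, starts the iteration. -/
theorem hilbertBound_trivial (hb : ∀ i, Integrable (b i) μ) :
    HilbertBound μ b (∑ i, ∫ t, ‖b i t‖ ∂μ) := by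
  intro ι _ R Z hZ
  rw [Finset.sum_mul]
  calc ∫ t, ‖∑ i, b i t • Z i‖ ∂μ ≤ ∫ t, ∑ i, ‖b i t‖ * R ∂μ := by
        refine integral_mono (integrable_sum_smul hb Z).norm
          (integrable_finsetSum _ fun i _ => (hb i).norm.mul_const _) fun t => ?_
        refine (norm_sum_le _ _).trans (Finset.sum_le_sum fun i _ => ?_)
        rw [norm_smul]
        exact mul_le_mul_of_nonneg_left (hZ i) (norm_nonneg _)
    _ = _ := by
        rw [integral_finsetSum _ fun i _ => (hb i).norm.mul_const _]
        simp only [integral_mul_const]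

/-- Truncation at height `2` leaves a remainder dominated by `u ^ 2 / 8`. -/
theorem sq_sub_truncate_le (u : ℝ) : (u - max (-2) (min 2 u)) ^ 2 ≤ u ^ 4 / 64 := by
  have h4 : u ^ 4 / 64 = (u ^ 2 / 8) ^ 2 := by ring
  rw [h4, sq_le_sq, abs_of_nonneg (by positivity : 0 ≤ u ^ 2 / 8), abs_le]
  rcases le_total 2 u with h | h
  · rw [min_eq_left h, max_eq_right (by norm_num)]
    constructor <;> nlinarith [sq_nonneg (u - 4)]
  · rw [min_eq_right h]
    rcases le_total (-2) u with h' | h'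
    · rw [max_eq_right h']; constructor <;> nlinarith [sq_nonneg u]
    · rw [max_eq_left h']; constructor <;> nlinarith [sq_nonneg (u + 4)]

theorem norm_truncation_remainder_le {n : ℕ} (a : EuclideanSpace ℝ (Fin n)) (ha : ‖a‖ ≤ 1) :
    ‖(WithLp.toLp 2 fun σ : Fin n → Bool =>
      signedSum σ a - max (-2) (min 2 (signedSum σ a)) : EuclideanSpace ℝ (Fin n → Bool))‖ ≤
      √(2 ^ n) / 4 := by
  refine le_of_sq_le_sq ?_ (by positivity)
  have hsq : ∑ i, a i ^ 2 = ‖a‖ ^ 2 := by simp [EuclideanSpace.norm_sq_eq]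
  rw [EuclideanSpace.norm_sq_eq, div_pow, Real.sq_sqrt (by positivity)]
  have h4 := sum_signedSum_pow_four_le a
  rw [hsq] at h4
  have h1 : (‖a‖ ^ 2) ^ 2 ≤ 1 := by
    rw [← pow_mul]; exact pow_le_one₀ (norm_nonneg _) ha
  calc _ ≤ ∑ σ : Fin n → Bool, signedSum σ a ^ 4 / 64 :=
        Finset.sum_le_sum fun σ _ => by simpa using sq_sub_truncate_le (signedSum σ a)
    _ = (∑ σ : Fin n → Bool, signedSum σ a ^ 4) / 64 := by rw [Finset.sum_div]
    _ ≤ (3 * 2 ^ n * 1) / 64 := by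
        gcongr
        exact h4.trans (by gcongr)
    _ ≤ _ := by
        have : (0 : ℝ) < 2 ^ n := by positivity
        linarith

theorem sum_abs_le_sqrt_card_mul_norm {ι : Type*} [Fintype ι] (w : EuclideanSpace ℝ ι) :
    ∑ i, |w i| ≤ √(Fintype.card ι) * ‖w‖ := by
  have h := Real.sum_mul_le_sqrt_mul_sqrt Finset.univ (fun _ : ι => (1 : ℝ)) fun i => |w i|
  simpa [EuclideanSpace.norm_eq] using h

/-- Truncated signed sums are scalar coefficients of size at most `2`, controlled by `β`. The
remainders form Hilbert vectors indexed by the signs, of normalized norm at most `1/4`, controlled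
by `Γ`; this is why `HilbertBound` quantifies over all finite index types. Khinchine's factor `2`
gives `4β + Γ/2`. -/
theorem HilbertBound.improve (hb : ∀ i, Integrable (b i) μ) {β Γ : ℝ}
    (hβ : ∀ x : Fin k → ℝ, ∀ R, (∀ i, |x i| ≤ R) → ∫ t, |∑ i, x i * b i t| ∂μ ≤ β * R)
    (h : HilbertBound μ b Γ) {n : ℕ} (Z : Fin k → EuclideanSpace ℝ (Fin n))
    (hZ : ∀ i, ‖Z i‖ ≤ 1) : ∫ t, ‖∑ i, b i t • Z i‖ ∂μ ≤ 4 * β + Γ / 2 := by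
  set X : (Fin n → Bool) → Fin k → ℝ := fun σ i => max (-2) (min 2 (signedSum σ (Z i))) with hX
  set Y : Fin k → EuclideanSpace ℝ (Fin n → Bool) := fun i =>
    WithLp.toLp 2 fun σ => signedSum σ (Z i) - max (-2) (min 2 (signedSum σ (Z i))) with hY
  have hXint : ∀ σ, Integrable (fun t => |∑ i, X σ i * b i t|) μ := fun σ =>
    (integrable_finsetSum _ fun i _ => (hb i).const_mul _).abs
  have hYint := (integrable_sum_smul hb Y).norm
  have hpt : ∀ t, 2 ^ n * ‖∑ i, b i t • Z i‖ ≤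
      2 * (∑ σ, |∑ i, X σ i * b i t|) + 2 * (√(2 ^ n) * ‖∑ i, b i t • Y i‖) := by
    intro t
    refine (khinchine_one_two _).trans ?_
    rw [← mul_add]
    refine mul_le_mul_of_nonneg_left ?_ zero_le_two
    have hcs := sum_abs_le_sqrt_card_mul_norm (∑ i, b i t • Y i)
    have hcard : ((Fintype.card (Fin n → Bool) : ℕ) : ℝ) = 2 ^ n := by simp
    rw [hcard] at hcs
    refine le_trans ?_ (add_le_add_right hcs _)
    rw [← Finset.sum_add_distrib]
    refine Finset.sum_le_sum fun σ _ => ?_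
    have e1 : signedSum σ (∑ i, b i t • Z i).ofLp = ∑ i, b i t * signedSum σ (Z i) := by
      rw [← signedSum_sum]; congr 1; ext s; simp
    have e2 : (∑ i, b i t • Y i) σ = ∑ i, b i t * Y i σ := by simp
    rw [e1, e2]
    refine le_trans (le_of_eq ?_) (abs_add_le _ _)
    rw [← Finset.sum_add_distrib]
    congr 1
    refine Finset.sum_congr rfl fun i _ => ?_
    simp only [hX, hY]; ring
  have hI : ∫ t, 2 ^ n * ‖∑ i, b i t • Z i‖ ∂μ ≤
      ∫ t, (2 * (∑ σ, |∑ i, X σ i * b i t|) + 2 * (√(2 ^ n) * ‖∑ i, b i t • Y i‖)) ∂μ :=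
    integral_mono ((integrable_sum_smul hb Z).norm.const_mul _)
      (((integrable_finsetSum _ fun σ _ => hXint σ).const_mul _).add
        ((hYint.const_mul _).const_mul _)) hpt
  rw [integral_add ((integrable_finsetSum _ fun σ _ => hXint σ).const_mul _)
    ((hYint.const_mul _).const_mul _), integral_const_mul, integral_const_mul, integral_const_mul,
    integral_const_mul, integral_finsetSum _ fun σ _ => hXint σ] at hI
  have hXb : ∑ σ, ∫ t, |∑ i, X σ i * b i t| ∂μ ≤ ∑ _σ : Fin n → Bool, β * 2 := by
    refine Finset.sum_le_sum fun σ _ => hβ _ _ fun i => ?_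
    rw [abs_le]
    exact ⟨le_max_left _ _, max_le (by norm_num) (min_le_left _ _)⟩
  have hYb := h _ (√(2 ^ n) / 4) Y fun i => norm_truncation_remainder_le (Z i) (hZ i)
  have hYb' := mul_le_mul_of_nonneg_left hYb (Real.sqrt_nonneg (2 ^ n))
  have hs : √((2 : ℝ) ^ n) * √(2 ^ n) = 2 ^ n := Real.mul_self_sqrt (by positivity)
  have e : √((2 : ℝ) ^ n) * (Γ * (√(2 ^ n) / 4)) = 2 ^ n * (Γ / 4) := by
    linear_combination (Γ / 4) * hs
  rw [e] at hYb'
  simp only [Finset.sum_const, Finset.card_univ, Fintype.card_pi, Fintype.card_bool,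
    Finset.prod_const, Fintype.card_fin, nsmul_eq_mul, Nat.cast_pow, Nat.cast_ofNat] at hXb
  refine le_of_mul_le_mul_left ?_ (by positivity : (0 : ℝ) < 2 ^ n)
  linarith

theorem HilbertBound.halve (hb : ∀ i, Integrable (b i) μ) {β c : ℝ}
    (hβ : ∀ x : Fin k → ℝ, ∀ R, (∀ i, |x i| ≤ R) → ∫ t, |∑ i, x i * b i t| ∂μ ≤ β * R)
    (h : HilbertBound μ b (8 * β + c)) : HilbertBound μ b (8 * β + c / 2) := by
  intro ι _ R Z hZ
  -- A negative `R` is possible only for `k = 0`; testing radii `1` and `-1` then forces `β = c =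
  -- 0`.
  rcases lt_trichotomy R 0 with hR | rfl | hR
  · have : IsEmpty (Fin k) := ⟨fun i => absurd (hZ i) (not_le.2 (hR.trans_le (norm_nonneg _)))⟩
    have h0 := h ι R Z hZ
    have h1 := hβ 0 (-1) (fun i => isEmptyElim i)
    have h2 := hβ 0 1 (fun i => isEmptyElim i)
    have h3 := h ι 1 Z (fun i => isEmptyElim i)
    have h4 := h ι (-1) Z (fun i => isEmptyElim i)
    simp at h0 h1 h2 h3 h4 ⊢
    have hβ0 : β = 0 := le_antisymm h1 h2
    have hc : c = 0 := by linarith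
    simp [hβ0, hc]
  · have : ∀ i, Z i = 0 := fun i => norm_le_zero_iff.1 (hZ i)
    simp [this]
  · let e := LinearIsometryEquiv.piLpCongrLeft 2 ℝ ℝ (Fintype.equivFin ι)
    have := h.improve hb hβ (fun i => R⁻¹ • e (Z i)) fun i => by
      rw [norm_smul, e.norm_map, norm_inv, Real.norm_of_nonneg hR.le]
      exact (inv_mul_le_one₀ hR).2 (hZ i)
    have e1 : ∀ t, ‖∑ i, b i t • R⁻¹ • e (Z i)‖ = R⁻¹ * ‖∑ i, b i t • Z i‖ := by
      intro t
      rw [← e.norm_map (∑ i, b i t • Z i), map_sum]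
      simp_rw [smul_comm _ R⁻¹, ← Finset.smul_sum, map_smul]
      rw [norm_smul, norm_inv, Real.norm_of_nonneg hR.le]
    simp_rw [e1] at this
    rw [integral_const_mul, inv_mul_le_iff₀ hR] at this
    linarith

/-- **Grothendieck's theorem**, with the constant `8`. -/
theorem hilbertBound_eight (hb : ∀ i, Integrable (b i) μ) {β : ℝ}
    (hβ : ∀ x : Fin k → ℝ, ∀ R, (∀ i, |x i| ≤ R) → ∫ t, |∑ i, x i * b i t| ∂μ ≤ β * R) :
    HilbertBound μ b (8 * β) := by
  obtain ⟨c, hc⟩ : ∃ c, HilbertBound μ b (8 * β + c) :=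
    ⟨(∑ i, ∫ t, ‖b i t‖ ∂μ) - 8 * β, by
      rw [add_sub_cancel]; exact hilbertBound_trivial hb⟩
  have hj : ∀ j : ℕ, HilbertBound μ b (8 * β + c / 2 ^ j) := by
    intro j
    induction j with
    | zero => simpa using hc
    | succ j ih => simpa [pow_succ, div_div] using ih.halve hb hβ
  intro ι _ R Z hZ
  have hlim : Filter.Tendsto (fun j : ℕ => (8 * β + c / 2 ^ j) * R) Filter.atTop
      (nhds ((8 * β + 0) * R)) := by
    refine Filter.Tendsto.mul_const _ (Filter.Tendsto.const_add _ ?_)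
    exact tendsto_const_nhds.div_atTop (tendsto_pow_atTop_atTop_of_one_lt one_lt_two)
  rw [add_zero] at hlim
  exact ge_of_tendsto' hlim fun j => hj j ι R Z hZ

/-! ### From Hilbert-valued bounds to square sums. -/

/-- The mixed-norm Minkowski inequality `‖(∫ |f s|)_s‖ ≤ ∫ ‖(f s)_s‖` in Euclidean space. -/
theorem sqrt_sum_sq_integral_abs_le {N : ℕ} {f : Fin N → α → ℝ} (hf : ∀ s, Integrable (f s) μ)
    (hint : Integrable (fun t => √(∑ s, f s t ^ 2)) μ) :
    √(∑ s, (∫ t, |f s t| ∂μ) ^ 2) ≤ ∫ t, √(∑ s, f s t ^ 2) ∂μ := by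
  set a : Fin N → ℝ := fun s => ∫ t, |f s t| ∂μ
  have hI : 0 ≤ ∫ t, √(∑ s, f s t ^ 2) ∂μ := integral_nonneg fun t => Real.sqrt_nonneg _
  rcases (Real.sqrt_nonneg (∑ s, a s ^ 2)).eq_or_lt with h0 | hpos
  · rw [← h0]; exact hI
  -- Duality: pair the vector of integrals with itself and apply Cauchy–Schwarz under the integral.
  refine le_of_mul_le_mul_left ?_ hpos
  rw [Real.mul_self_sqrt (Finset.sum_nonneg fun s _ => sq_nonneg _)]
  calc ∑ s, a s ^ 2 = ∑ s, ∫ t, a s * |f s t| ∂μ := by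
        simp only [integral_const_mul, a, sq]
    _ = ∫ t, ∑ s, a s * |f s t| ∂μ :=
        (integral_finsetSum _ fun s _ => (hf s).abs.const_mul _).symm
    _ ≤ ∫ t, √(∑ s, a s ^ 2) * √(∑ s, f s t ^ 2) ∂μ := by
        refine integral_mono (integrable_finsetSum _ fun s _ => (hf s).abs.const_mul _)
          (hint.const_mul _) fun t => ?_
        simpa using Real.sum_mul_le_sqrt_mul_sqrt Finset.univ a fun s => |f s t|
    _ = _ := integral_const_mul _ _

/-- Reading the array `z` by coordinates `i` gives vectors `Z i` of norm at most `R`. Grothendieck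
bounds the integral of the square function, and Minkowski compares it with the square sum of norms.
-/
theorem sqrt_sum_norm_sq_le_of_pi {N : ℕ} (B : (Fin k → ℝ) →L[ℝ] Lp ℝ 1 μ)
    (z : Fin N → Fin k → ℝ) {R : ℝ} (hR : 0 ≤ R) (hz : ∀ i, ∑ s, z s i ^ 2 ≤ R ^ 2) :
    √(∑ s, ‖B (z s)‖ ^ 2) ≤ 8 * ‖B‖ * R := by
  classical
  set b : Fin k → α → ℝ := fun i => B (Pi.single i 1)
  have hb : ∀ i, Integrable (b i) μ := fun i => L1.integrable_coeFn _
  have hB : ∀ x : Fin k → ℝ, B x =ᵐ[μ] fun t => ∑ i, x i * b i t := by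
    intro x
    have hx : B x = ∑ i, x i • B (Pi.single i 1) := by
      conv_lhs => rw [pi_eq_sum_univ' x]
      rw [map_sum]
      refine Finset.sum_congr rfl fun i _ => ?_
      rw [map_smul]
    rw [hx]
    refine (Lp.coeFn_finsetSum _ _).trans ?_
    have h : ∀ᵐ t ∂μ, ∀ i, (x i • B (Pi.single i 1) : Lp ℝ 1 μ) t = x i * b i t :=
      ae_all_iff.2 fun i => Lp.coeFn_smul _ _
    filter_upwards [h] with t ht
    simp [ht]
  have hnorm : ∀ x : Fin k → ℝ, ‖B x‖ = ∫ t, |∑ i, x i * b i t| ∂μ := by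
    intro x
    rw [L1.norm_eq_integral_norm]
    refine integral_congr_ae ?_
    filter_upwards [hB x] with t ht
    rw [ht, Real.norm_eq_abs]
  have hβ : ∀ x : Fin k → ℝ, ∀ R, (∀ i, |x i| ≤ R) →
      ∫ t, |∑ i, x i * b i t| ∂μ ≤ ‖B‖ * R := by
    intro x R hx
    rcases isEmpty_or_nonempty (Fin k) with hk | hk
    · have : ‖B‖ = 0 := by
        rw [norm_eq_zero]; ext1 x; rw [Subsingleton.elim x 0]; simp
      simp [this]
    · rw [← hnorm]
      exact (B.le_opNorm x).trans
        (mul_le_mul_of_nonneg_left ((pi_norm_le_iff_of_nonempty _).2 hx) (norm_nonneg _))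
  let Z : Fin k → EuclideanSpace ℝ (Fin N) := fun i => WithLp.toLp 2 fun s => z s i
  have hZ : ∀ i, ‖Z i‖ ≤ R := fun i => by
    refine le_of_sq_le_sq ?_ hR
    simpa [EuclideanSpace.norm_sq_eq, Z] using hz i
  have hpt : ∀ t, ‖∑ i, b i t • Z i‖ = √(∑ s, (∑ i, z s i * b i t) ^ 2) := by
    intro t
    simp [EuclideanSpace.norm_eq, Z, mul_comm]
  have hG := hilbertBound_eight hb hβ (Fin N) R Z hZ
  have hint := (integrable_sum_smul hb Z).norm
  simp_rw [hpt] at hG hint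
  simp_rw [hnorm]
  exact (sqrt_sum_sq_integral_abs_le
    (fun s => integrable_finsetSum _ fun i _ => (hb i).const_mul _) hint).trans hG

end

/-! ### Compact convex hulls and Pietsch domination. -/

/-- By Carathéodory, `dim + 1` points suffice, so the hull is a continuous image of a simplex times
a power of `s`. Shorter combinations are padded with weight `0` at `x₀`. -/
theorem IsCompact.isCompact_convexHull {E : Type*} [AddCommGroup E] [Module ℝ E]
    [TopologicalSpace E] [ContinuousAdd E] [ContinuousSMul ℝ E] [FiniteDimensional ℝ E] {s : Set E} (hs : IsCompact s) : IsCompact (convexHull ℝ s) := by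
  rcases s.eq_empty_or_nonempty with rfl | ⟨x₀, hx₀⟩
  · simp
  let d := Module.finrank ℝ E + 1
  let f : (Fin d → ℝ) × (Fin d → E) → E := fun p => ∑ i, p.1 i • p.2 i
  have hf : Continuous f := by fun_prop
  have hc : IsCompact (f '' (stdSimplex ℝ (Fin d) ×ˢ Set.univ.pi fun _ => s)) :=
    ((isCompact_stdSimplex ℝ _).prod (isCompact_univ_pi fun _ => hs)).image hf
  convert hc
  ext x
  constructor
  · intro hx
    obtain ⟨ι, _, z, w, hz, hind, hw, hw1, rfl⟩ := eq_pos_convex_span_of_mem_convexHull hx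
    have hcard : Fintype.card ι ≤ Fintype.card (Fin d) := by
      rw [Fintype.card_fin]
      exact hind.card_le_finrank_succ.trans (Nat.succ_le_succ (Submodule.finrank_le _))
    obtain ⟨e⟩ := Function.Embedding.nonempty_of_card_le hcard
    have hout : ∀ j ∉ Set.range e, Function.extend e w 0 j = 0 := fun j hj => by
      rw [Function.extend_apply' _ _ _ hj]; rfl
    refine ⟨(Function.extend e w 0, Function.extend e z fun _ => x₀), ⟨⟨fun j => ?_, ?_⟩, ?_⟩, ?_⟩
    · by_cases hj : j ∈ Set.range e
      · obtain ⟨i, rfl⟩ := hj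
        simpa [e.injective.extend_apply] using (hw i).le
      · exact (hout j hj).ge
    · rw [← hw1]
      exact (Fintype.sum_of_injective e e.injective _ _ hout
        fun i => (e.injective.extend_apply _ _ _).symm).symm
    · intro j _
      by_cases hj : j ∈ Set.range e
      · obtain ⟨i, rfl⟩ := hj
        simpa [e.injective.extend_apply] using hz ⟨i, rfl⟩
      · simpa [Function.extend_apply' _ _ _ hj] using hx₀
    · refine (Fintype.sum_of_injective e e.injective _ _ (fun j hj => ?_) fun i => ?_).symm
      · simp only [hout j hj, zero_smul]
      · simp only [e.injective.extend_apply]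
  · rintro ⟨⟨w, z⟩, ⟨hw, hz⟩, rfl⟩
    exact (convex_convexHull ℝ s).sum_mem (fun i _ => hw.1 i) hw.2
      fun i _ => subset_convexHull ℝ s (hz i trivial)

section
variable {E F : Type*} [NormedAddCommGroup E] [NormedSpace ℝ E] [NormedAddCommGroup F]
  [NormedSpace ℝ F]

/-- The bilinear forms `(x, y) ↦ φ x * φ y` with `‖φ‖ ≤ 1`. -/
def dualSquares (E : Type*) [NormedAddCommGroup E] [NormedSpace ℝ E] :
    Set (E →L[ℝ] StrongDual ℝ E) :=
  (fun φ : StrongDual ℝ E => φ.smulRight φ) '' Metric.closedBall 0 1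

theorem isCompact_dualSquares [FiniteDimensional ℝ E] : IsCompact (dualSquares E) := by
  have : ProperSpace (StrongDual ℝ E) := FiniteDimensional.proper_real _
  refine (isCompact_closedBall _ _).image ?_
  exact ((ContinuousLinearMap.smulRightL ℝ E (StrongDual ℝ E)).continuous).clm_apply continuous_id

theorem isCompact_convexHull_dualSquares [FiniteDimensional ℝ E] :
    IsCompact (convexHull ℝ (dualSquares E)) :=
  isCompact_dualSquares.isCompact_convexHull

/-- `T` is `2`-summing with constant `C`, in homogeneous form. -/
def TwoSummingWith (T : E →L[ℝ] F) (C : ℝ) : Prop :=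
  ∀ (N : ℕ) (z : Fin N → E) (t : ℝ), 0 < t →
    (∀ φ : StrongDual ℝ E, ‖φ‖ ≤ 1 → ∑ s, φ (z s) ^ 2 ≤ t) → ∑ s, ‖T (z s)‖ ^ 2 ≤ C ^ 2 * t

/-- If no form works, Hahn–Banach separates the values of the forms from an orthant. The separating
weights `w` are nonnegative, and the vectors `√(w s) • x s` violate the `2`-summing inequality. -/
theorem TwoSummingWith.exists_form_on_finite [FiniteDimensional ℝ E] {T : E →L[ℝ] F} {C : ℝ}
    (hC : 0 < C) (hT : TwoSummingWith T C) {N : ℕ} (x : Fin N → E) :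
    ∃ q ∈ convexHull ℝ (dualSquares E), ∀ s, ‖T (x s)‖ ^ 2 ≤ C ^ 2 * q (x s) (x s) := by
  classical
  let L : (E →L[ℝ] StrongDual ℝ E) →ₗ[ℝ] Fin N → ℝ :=
    { toFun := fun q s => C ^ 2 * q (x s) (x s)
      map_add' := fun p q => by ext s; simp [mul_add]
      map_smul' := fun c q => by ext s; simp; ring }
  have hL : Continuous L := by
    refine continuous_pi fun s => ?_
    change Continuous fun q : E →L[ℝ] StrongDual ℝ E => C ^ 2 * q (x s) (x s)
    fun_prop
  let D : Set (Fin N → ℝ) := Set.Ici fun s => ‖T (x s)‖ ^ 2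
  by_contra! hne
  have hdisj : Disjoint (L '' convexHull ℝ (dualSquares E)) D := by
    rw [Set.disjoint_left]
    rintro _ ⟨q, hq, rfl⟩ hD
    obtain ⟨s, hs⟩ := hne q hq
    exact absurd (hD s) (not_le.2 hs)
  obtain ⟨f, u, v, hfu, huv, hfv⟩ := geometric_hahn_banach_compact_closed
    ((convex_convexHull ℝ (dualSquares E)).linear_image L)
    (isCompact_convexHull_dualSquares.image hL) (convex_Ici _) isClosed_Ici hdisj
  set w : Fin N → ℝ := fun s => f (Pi.single s 1)
  have hf : ∀ a : Fin N → ℝ, f a = ∑ s, a s * w s := fun a => by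
    conv_lhs => rw [pi_eq_sum_univ' a]
    simp [map_sum, w]
  set a₀ : Fin N → ℝ := fun s => ‖T (x s)‖ ^ 2
  have hw : ∀ s, 0 ≤ w s := by
    intro s
    by_contra! hs
    have hlt : v < f a₀ := hfv a₀ Set.self_mem_Ici
    have hpos : 0 ≤ (f a₀ - v) / -w s := div_nonneg (by linarith) (by linarith)
    -- The step along the negative direction is just long enough to bring `f` down to `v`, against
    -- strict separation.
    have hmem : a₀ + ((f a₀ - v) / -w s) • Pi.single s 1 ∈ D := fun i =>
      le_add_of_nonneg_right (mul_nonneg hpos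
        ((Pi.single_nonneg (α := fun _ => ℝ)).2 zero_le_one i))
    have h := hfv _ hmem
    have e : (f a₀ - v) / -w s * w s = v - f a₀ := by
      rw [div_neg, neg_mul, div_mul_cancel₀ _ hs.ne, neg_sub]
    rw [map_add, map_smul, smul_eq_mul] at h
    change v < f a₀ + (f a₀ - v) / -w s * w s at h
    linarith
  have hφ : ∀ φ : StrongDual ℝ E, ‖φ‖ ≤ 1 → ∑ s, C ^ 2 * φ (x s) ^ 2 * w s < u := by
    intro φ hφ
    have h := hfu _ ⟨_, subset_convexHull ℝ _ ⟨φ, by simpa using hφ, rfl⟩, rfl⟩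
    rw [hf] at h
    refine lt_of_eq_of_lt (Finset.sum_congr rfl fun s _ => ?_) h
    simp [L, sq]
  have hu : 0 < u := by simpa using hφ 0 (by simp)
  have hmain := hT N (fun s => √(w s) • x s) (u / C ^ 2) (by positivity) fun φ h => by
    rw [le_div_iff₀ (by positivity), mul_comm, Finset.mul_sum]
    refine le_trans (le_of_eq (Finset.sum_congr rfl fun s _ => ?_)) (hφ φ h).le
    rw [map_smul, smul_eq_mul, mul_pow, Real.sq_sqrt (hw s)]; ring
  have hv := hfv a₀ Set.self_mem_Ici
  rw [hf] at hv
  have e : ∑ s, ‖T (√(w s) • x s)‖ ^ 2 = ∑ s, a₀ s * w s := by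
    refine Finset.sum_congr rfl fun s _ => ?_
    rw [map_smul, norm_smul, mul_pow, Real.norm_eq_abs, sq_abs, Real.sq_sqrt (hw s), mul_comm]
  rw [e, mul_div_cancel₀ _ (by positivity)] at hmain
  linarith

/-- Pietsch's domination theorem for operators on finite-dimensional spaces. -/
theorem TwoSummingWith.exists_form [FiniteDimensional ℝ E] {T : E →L[ℝ] F} {C : ℝ} (hC : 0 < C)
    (hT : TwoSummingWith T C) :
    ∃ q ∈ convexHull ℝ (dualSquares E), ∀ x, ‖T x‖ ^ 2 ≤ C ^ 2 * q x x := by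
  have h := isCompact_convexHull_dualSquares.inter_iInter_nonempty
    (fun x : E => {q : E →L[ℝ] StrongDual ℝ E | ‖T x‖ ^ 2 ≤ C ^ 2 * q x x})
    (fun x => isClosed_le continuous_const (by fun_prop)) fun X => by
      obtain ⟨q, hq, h⟩ := hT.exists_form_on_finite hC fun s => (X.equivFin.symm s : E)
      refine ⟨q, hq, Set.mem_iInter₂.2 fun x hx => ?_⟩
      simpa using h (X.equivFin ⟨x, hx⟩)
  obtain ⟨q, hq, h⟩ := h
  exact ⟨q, hq, fun x => Set.mem_iInter.1 h x⟩

/-! ### Uniform averages and factorization through `ι_k`. -/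

/-- A convex combination is dominated, up to a factor `2`, by a uniform average. -/
theorem exists_uniform_average {ι : Type*} [Fintype ι] (w : ι → ℝ) (hw : ∀ i, 0 ≤ w i)
    (hw1 : ∑ i, w i = 1) : ∃ (N : ℕ+) (g : Fin N → ι), ∀ a : ι → ℝ, (∀ i, 0 ≤ a i) →
      ∑ i, w i * a i ≤ 2 * ((N : ℝ)⁻¹ * ∑ l, a (g l)) := by
  set r : ℝ := (Fintype.card ι : ℝ)
  -- Rounding up adds less than `1` per index, hence at most `r` to a total of `r`: this is the
  -- factor `2`.
  let n : ι → ℕ := fun i => ⌈r * w i⌉₊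
  have hr : 0 < r := by
    rcases isEmpty_or_nonempty ι with h | h
    · simp at hw1
    · exact Nat.cast_pos.2 Fintype.card_pos
  have hge : ∀ i, r * w i ≤ n i := fun i => Nat.le_ceil _
  have hN : ((∑ i, n i : ℕ) : ℝ) ≤ 2 * r := by
    push_cast
    calc ∑ i, (n i : ℝ) ≤ ∑ i, (r * w i + 1) :=
          Finset.sum_le_sum fun i _ => (Nat.ceil_lt_add_one (mul_nonneg hr.le (hw i))).le
      _ = 2 * r := by
          rw [Finset.sum_add_distrib, ← Finset.mul_sum, hw1]; simp [r]; ring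
  have hpos : 0 < ∑ i, n i := by
    have : (0 : ℝ) < ((∑ i, n i : ℕ) : ℝ) := by
      refine hr.trans_le ?_
      push_cast
      calc r = ∑ i, r * w i := by rw [← Finset.mul_sum, hw1, mul_one]
        _ ≤ _ := Finset.sum_le_sum fun i _ => hge i
    exact_mod_cast this
  let e : (Σ i, Fin (n i)) ≃ Fin (∑ i, n i) := Fintype.equivFinOfCardEq (by simp)
  refine ⟨⟨_, hpos⟩, fun l => (e.symm l).1, fun a ha => ?_⟩
  have hsum : ∑ l, a (e.symm l).1 = ∑ i, n i * a i := by
    rw [e.symm.sum_comp fun p => a p.1, Fintype.sum_sigma]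
    simp
  change _ ≤ 2 * (((∑ i, n i : ℕ) : ℝ)⁻¹ * ∑ l : Fin (∑ i, n i), a (e.symm l).1)
  rw [hsum]
  have hpos' : (0 : ℝ) < ((∑ i, n i : ℕ) : ℝ) := by exact_mod_cast hpos
  have h1 : r * ∑ i, w i * a i ≤ ∑ i, n i * a i := by
    rw [Finset.mul_sum]
    refine Finset.sum_le_sum fun i _ => ?_
    rw [← mul_assoc]
    exact mul_le_mul_of_nonneg_right (hge i) (ha i)
  have h2 : 0 ≤ ∑ i, w i * a i := Finset.sum_nonneg fun i _ => mul_nonneg (hw i) (ha i)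
  rw [← mul_assoc, mul_comm 2, mul_assoc, ← div_eq_inv_mul, le_div_iff₀ hpos']
  calc _ ≤ (∑ i, w i * a i) * (2 * r) := mul_le_mul_of_nonneg_left hN h2
    _ ≤ _ := by linarith

theorem exists_sum_sq_of_mem_convexHull {q : E →L[ℝ] StrongDual ℝ E}
    (hq : q ∈ convexHull ℝ (dualSquares E)) : ∃ (ι : Type) (_ : Fintype ι) (w : ι → ℝ)
      (ψ : ι → StrongDual ℝ E), (∀ i, 0 ≤ w i) ∧ ∑ i, w i = 1 ∧ (∀ i, ‖ψ i‖ ≤ 1) ∧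
        ∀ x, q x x = ∑ i, w i * ψ i x ^ 2 := by
  have h := (mem_convexHull_iff_exists_fintype (s := dualSquares E) (x := q)).1 hq
  obtain ⟨ι, hι, w, z, hw, hw1, hz, hq⟩ := h
  choose ψ hψ hψz using hz
  refine ⟨ι, hι, w, ψ, hw, hw1, fun i => by simpa using hψ i, fun x => ?_⟩
  rw [← hq, sum_apply, sum_apply]
  refine Finset.sum_congr rfl fun i _ => ?_
  rw [← hψz i, smul_apply, smul_apply, ContinuousLinearMap.smulRight_apply, smul_apply, sq]
  rfl

theorem TwoSummingWith.exists_average [FiniteDimensional ℝ E] {T : E →L[ℝ] F} {C : ℝ} (hC : 0 < C)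
    (hT : TwoSummingWith T C) : ∃ (N : ℕ+) (φ : Fin N → StrongDual ℝ E), (∀ l, ‖φ l‖ ≤ 1) ∧
      ∀ x, ‖T x‖ ^ 2 ≤ 2 * C ^ 2 * ((N : ℝ)⁻¹ * ∑ l, φ l x ^ 2) := by
  obtain ⟨q, hq, h⟩ := hT.exists_form hC
  obtain ⟨ι, _, w, ψ, hw, hw1, hψ, hqw⟩ := exists_sum_sq_of_mem_convexHull hq
  obtain ⟨N, g, hg⟩ := exists_uniform_average w hw hw1
  refine ⟨N, fun l => ψ (g l), fun l => hψ (g l), fun x => (h x).trans ?_⟩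
  have := hg (fun i => ψ i x ^ 2) fun i => sq_nonneg _
  rw [hqw]
  calc _ ≤ C ^ 2 * (2 * ((N : ℝ)⁻¹ * ∑ l, ψ (g l) x ^ 2)) := by gcongr
    _ = _ := by ring

theorem norm_formalIdentity_apply_sq (k : ℕ+) (x : EllInf k) :
    ‖formalIdentity k x‖ ^ 2 = (k : ℝ)⁻¹ * ∑ i, x i ^ 2 := by
  have hae : formalIdentity k x =ᵐ[unifMeasure k] x := (memLp_unifMeasure k x).coeFn_toLp
  rw [← real_inner_self_eq_norm_sq, L2.inner_def]
  have : ∫ i, inner ℝ (formalIdentity k x i) (formalIdentity k x i) ∂unifMeasure k =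
      ∫ i, x i ^ 2 ∂unifMeasure k := by
    refine integral_congr_ae ?_
    filter_upwards [hae] with i hi
    rw [hi]; simp [sq]
  rw [this, unifMeasure, integral_smul_measure, integral_countable]
  · simp [tsum_fintype]
  · exact Integrable.of_finite

theorem norm_formalIdentity_le (k : ℕ+) : ‖formalIdentity k‖ ≤ 1 := by
  refine ContinuousLinearMap.opNorm_le_bound _ zero_le_one fun x => ?_
  rw [one_mul]
  refine le_of_sq_le_sq ?_ (norm_nonneg _)
  have hk : (0 : ℝ) < k := by exact_mod_cast k.pos
  rw [norm_formalIdentity_apply_sq, inv_mul_le_iff₀ hk]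
  calc ∑ i, x i ^ 2 ≤ ∑ _i : Fin k, ‖x‖ ^ 2 := Finset.sum_le_sum fun i _ =>
        sq_le_sq.2 (by simpa using norm_le_pi_norm x i)
    _ = _ := by simp

/-- An operator dominated by an operator into a Hilbert space factors through it. -/
theorem exists_factor_of_norm_le {H : Type*} [NormedAddCommGroup H] [InnerProductSpace ℝ H]
    [FiniteDimensional ℝ E] (T : E →L[ℝ] F) (S : E →L[ℝ] H) {c : ℝ} (hc : 0 ≤ c)
    (h : ∀ x, ‖T x‖ ≤ c * ‖S x‖) : ∃ B : H →L[ℝ] F, T = B ∘L S ∧ ‖B‖ ≤ c := by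
  obtain ⟨g, hg⟩ := S.toLinearMap.rangeRestrict.exists_rightInverse_of_surjective
    S.toLinearMap.range_rangeRestrict
  have hg' : ∀ y, S (g y) = y := fun y => congrArg Subtype.val (LinearMap.congr_fun hg y)
  let B₀ : S.toLinearMap.range →L[ℝ] F := (T.toLinearMap ∘ₗ g).mkContinuous c fun y => by
    have := h (g y)
    rw [hg'] at this
    exact this
  refine ⟨B₀ ∘L S.toLinearMap.range.orthogonalProjectionOnto, ?_, ?_⟩
  · ext x
    have hp : S.toLinearMap.range.orthogonalProjectionOnto (S x) = ⟨S x, x, rfl⟩ :=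
      Submodule.orthogonalProjectionOnto_mem_subspace_eq_self (K := S.toLinearMap.range)
        ⟨S x, x, rfl⟩
    rw [ContinuousLinearMap.comp_apply, ContinuousLinearMap.comp_apply, hp]
    change T x = T (g ⟨S x, x, rfl⟩)
    -- Domination makes `T` constant on the fibres of `S`, so the choice of preimage `g` is
    -- harmless.
    rw [← sub_eq_zero, ← map_sub, ← norm_le_zero_iff]
    refine (h _).trans (le_of_eq ?_)
    rw [map_sub, hg', sub_self, norm_zero, mul_zero]
  · refine (ContinuousLinearMap.opNorm_comp_le _ _).trans ?_
    have h₁ : ‖B₀‖ ≤ c := LinearMap.mkContinuous_norm_le _ hc _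
    have h₂ := Submodule.orthogonalProjectionOnto_norm_le S.toLinearMap.range
    nlinarith [norm_nonneg B₀]

theorem TwoSummingWith.exists_factor [FiniteDimensional ℝ E] {T : E →L[ℝ] F} {C : ℝ} (hC : 0 < C)
    (hT : TwoSummingWith T C) : ∃ (k : ℕ+) (A : E →L[ℝ] EllInf k) (B : LTwoOmega k →L[ℝ] F),
      T = B ∘L formalIdentity k ∘L A ∧ ‖A‖ * ‖B‖ ≤ √2 * C := by
  obtain ⟨N, φ, hφ, h⟩ := hT.exists_average hC
  let A : E →L[ℝ] EllInf N := ContinuousLinearMap.pi φ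
  have hA : ‖A‖ ≤ 1 := ContinuousLinearMap.opNorm_le_bound _ zero_le_one fun x => by
    refine (pi_norm_le_iff_of_nonneg (by positivity)).2 fun l => ?_
    exact (φ l).le_of_opNorm_le (hφ l) x
  obtain ⟨B, hB, hBn⟩ := exists_factor_of_norm_le T (formalIdentity N ∘L A)
    (c := √2 * C) (by positivity) fun x => by
      refine le_of_sq_le_sq ?_ (by positivity)
      rw [mul_pow, mul_pow, Real.sq_sqrt zero_le_two]
      exact (h x).trans_eq (by rw [ContinuousLinearMap.comp_apply, norm_formalIdentity_apply_sq]; rfl)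
  refine ⟨N, A, B, hB, ?_⟩
  calc ‖A‖ * ‖B‖ ≤ 1 * (√2 * C) := mul_le_mul hA hBn (norm_nonneg _) zero_le_one
    _ = _ := one_mul _

/-! ### Estimates for `π_2` and the equivalence. -/

theorem twoSummingWith_of_twoSummingNorm_le {T : E →L[ℝ] F} {C : ℝ} (hC : 0 ≤ C)
    (h : twoSummingNorm T ≤ ENNReal.ofReal C) : TwoSummingWith T C := by
  intro N z t ht hz
  have hs : 0 < √t := Real.sqrt_pos.2 ht
  have hsq : √t ^ 2 = t := Real.sq_sqrt ht.le
  have h1 : ENNReal.ofReal √(∑ s, ‖T ((√t)⁻¹ • z s)‖ ^ 2) ≤ ENNReal.ofReal C := by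
    refine le_trans ?_ h
    refine le_iSup_of_le N (le_iSup_of_le (fun s => (√t)⁻¹ • z s) (le_iSup_of_le ?_ le_rfl))
    intro φ hφ
    simp only [map_smul, smul_eq_mul, sq_abs, mul_pow, ← Finset.mul_sum, inv_pow, hsq]
    rw [inv_mul_le_iff₀ ht, mul_one]
    exact hz φ hφ
  rw [ENNReal.ofReal_le_ofReal_iff hC, Real.sqrt_le_left hC] at h1
  simp only [map_smul, norm_smul, mul_pow, ← Finset.mul_sum, norm_inv, Real.norm_eq_abs, sq_abs,
    inv_pow, hsq] at h1
  rwa [inv_mul_le_iff₀ ht, mul_comm] at h1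

theorem sum_sq_apply_le {N : ℕ} {z : Fin N → E}
    (hz : ∀ φ : StrongDual ℝ E, ‖φ‖ ≤ 1 → ∑ s, |φ (z s)| ^ 2 ≤ 1) (φ : StrongDual ℝ E) :
    ∑ s, φ (z s) ^ 2 ≤ ‖φ‖ ^ 2 := by
  rcases eq_or_ne φ 0 with rfl | hφ
  · simp
  have h0 : 0 < ‖φ‖ := norm_pos_iff.2 hφ
  have h := hz (‖φ‖⁻¹ • φ) (by rw [norm_smul, norm_inv, norm_norm, inv_mul_cancel₀ h0.ne'])
  simp only [smul_apply, smul_eq_mul, sq_abs, mul_pow, ← Finset.mul_sum,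
    inv_pow] at h
  rwa [inv_mul_le_iff₀ (by positivity), mul_one] at h

theorem twoSummingNorm_comp_le {α : Type*} [MeasurableSpace α] {μ : Measure α} {k : ℕ}
    (A : E →L[ℝ] EllInf k) (B : EllInf k →L[ℝ] Lp ℝ 1 μ) :
    twoSummingNorm (B ∘L A) ≤ ENNReal.ofReal (8 * (‖A‖ * ‖B‖)) := by
  refine iSup_le fun N => iSup_le fun z => iSup_le fun hz => ENNReal.ofReal_le_ofReal ?_
  have h := sqrt_sum_norm_sq_le_of_pi B (fun s => A (z s)) (norm_nonneg A) fun i => by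
    let φ : StrongDual ℝ E := (ContinuousLinearMap.proj i : EllInf k →L[ℝ] ℝ) ∘L A
    refine (sum_sq_apply_le hz φ).trans ?_
    gcongr
    exact ContinuousLinearMap.opNorm_le_bound _ (norm_nonneg _) fun x =>
      (norm_le_pi_norm (A x) i).trans (A.le_opNorm x)
  exact h.trans_eq (by ring)

end

theorem theorem5p1 (T : ∀ m : ℕ+, EllInfEllOne m →L[ℝ] LOne)
    (hT : ∃ M : ℝ, ∀ m, ‖T m‖ ≤ M) :
    List.TFAE
      [UniformlyFactorThrough T (fun k : ℕ+ => ContinuousLinearMap.id ℝ (EllInf k)),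
       (⨆ m, twoSummingNorm (T m)) < ∞,
       UniformlyFactorThrough T formalIdentity] := by
  tfae_have 1 → 2 := by
    rintro ⟨C, -, h⟩
    refine lt_of_le_of_lt (iSup_le fun m => ?_) (ENNReal.ofReal_lt_top (r := 8 * C))
    obtain ⟨k, A, B, hU, hAB⟩ := h m
    rw [hU, ContinuousLinearMap.id_comp]
    exact (twoSummingNorm_comp_le A B).trans (ENNReal.ofReal_le_ofReal (by linarith))
  tfae_have 2 → 3 := by
    intro h
    -- The `+ 1` keeps `C` positive even if every `T m` vanishes.
    set C := (⨆ m, twoSummingNorm (T m)).toReal + 1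
    have hC : 0 < C := by positivity
    refine ⟨√2 * C, by positivity, fun m => ?_⟩
    refine (twoSummingWith_of_twoSummingNorm_le hC.le ?_).exists_factor hC
    refine (le_iSup (fun m => twoSummingNorm (T m)) m).trans ?_
    exact (ENNReal.le_ofReal_iff_toReal_le h.ne hC.le).2 (by simp [C])
  tfae_have 3 → 1 := by
    rintro ⟨C, hC, h⟩
    refine ⟨C, hC, fun m => ?_⟩
    obtain ⟨k, A, B, hU, hAB⟩ := h m
    refine ⟨k, A, B ∘L formalIdentity k, hU, le_trans ?_ hAB⟩
    refine mul_le_mul_of_nonneg_left ?_ (norm_nonneg A)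
    calc _ ≤ ‖B‖ * ‖formalIdentity k‖ := ContinuousLinearMap.opNorm_comp_le _ _
      _ ≤ ‖B‖ * 1 := mul_le_mul_of_nonneg_left (norm_formalIdentity_le k) (norm_nonneg _)
      _ = ‖B‖ := mul_one _
  tfae_finish
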